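/- Let $F$ be a field of characteristic $0$, let $n\ge 2$, and let $L$ be a finite-dimensional $n$-ary algebra over $F$, that is, a finite-dimensional $F$-vector space with an $n$-linear multiplication $[\cdot,\ldots,\cdot]\colon L^n\to L$. Let $QDer_{LL}(L)$ be the space of all linear maps $f\colon L\to L$ for which there is a linear map $d\colon L\to L$ such that $$d([a_1,\ldots,a_n])=\sum_{i=1}^n[a_1,\ldots,a_{i-1},f(a_i),a_{i+1},\ldots,a_n]\qquad\text{for all } a_1,\ldots,a_n\in L.$$ Call $L$ commutative (respectively anticommutative) if $[x_{\sigma(1)},\ldots,x_{\sigma(n)}]$ equals $[x_1,\ldots,x_n]$ (respectively $\operatorname{sgn}(\sigma)[x_1,\ldots,x_n]$) for all $\sigma\in S_n$ and all $x_1,\ldots,x_n\in L$. A Filippov algebra is an anticommutative $n$-ary algebra such that $$[[x_1,\ldots,x_n],y_2,\ldots,y_n]=\sum_{i=1}^n[x_1,\ldots,[x_i,y_2,\ldots,y_n],\ldots,x_n]$$ for all $x_1,\ldots,x_n,y_2,\ldots,y_n$. Consider the following $n$-ary algebras over $F$: * for $\alpha\in F$, the $1$-dimensional algebra $L_\alpha$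 with basis $v$ and $[v,\ldots,v]=\alpha v$; * the $n$-dimensional anticommutative algebra $A_n$ with basis $e_1,\ldots,e_n$ and $[e_1,\ldots,e_n]=e_1$; * for an $(n+1)\times(n+1)$ matrix $B=(\beta_{ki})$ over $F$, the $(n+1)$-dimensional anticommutative algebra $L_B$ with basis $e_1,\ldots,e_{n+1}$ and $(-1)^{n+i+1}[e_1,\ldots,\widehat{e_i},\ldots,e_{n+1}]=\sum_{k=1}^{n+1}\beta_{ki}e_k$ for $i=1,\ldots,n+1$; * $D_{n+1}=L_I$ with $I$ the identity matrix, so that $[e_1,\ldots,\widehat{e_i},\ldots,e_{n+1}]=(-1)^{n+i+1}e_i$. **Theorem 4.6.** Suppose that $QDer_{LL}(L)=\operatorname{End}(L)$, the space of all linear maps $L\to L$. 1. If $L$ is commutative, then either $L$ has zero product, or $L\cong L_\alpha$ for some nonzero $\alpha\in F$. Moreover, if $F$ is algebraically closed and the product of $L$ is nonzero, then there is a bilinear multiplication $\cdot$ on $L$ such that $(L,\cdot)\cong F$ as $F$-algebras and $[x_1,\ldots,x_n]=x_1\cdot\ldots\cdot x_n$ for all $x_1,\ldots,x_n\in L$.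 2. If $L$ is anticommutative, then either $L$ has zero product, or $L\cong A_n$, or $L\cong L_B$ for some nondegenerate $(n+1)\times(n+1)$ matrix $B$ over $F$. Moreover, in the last case ($L\cong L_B$ with $B$ nondegenerate), if $L$ is a Filippov algebra and $F$ is algebraically closed, then $L\cong D_{n+1}$. -/

import Mathlib

namespace NAry

/-- The multiplication of an `n`-ary algebra on the `F`-space `L`: an `n`-linear map
`L × ⋯ × L → L`. -/
abbrev Mul (F : Type*) [Field F] (n : ℕ) (L : Type*) [AddCommGroup L] [Module F L] :=
  MultilinearMap F (fun _ : Fin n => L) L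

section

variable {F : Type*} [Field F] {n : ℕ}
variable {L : Type*} [AddCommGroup L] [Module F L]
variable {L' : Type*} [AddCommGroup L'] [Module F L']

/-- `[x_{σ(1)}, …, x_{σ(n)}] = [x_1, …, x_n]` for all `σ ∈ S_n`. -/
def IsCommutative (μ : Mul F n L) : Prop :=
  ∀ (σ : Equiv.Perm (Fin n)) (x : Fin n → L), μ (fun i => x (σ i)) = μ x

/-- `[x_{σ(1)}, …, x_{σ(n)}] = sgn(σ) [x_1, …, x_n]` for all `σ ∈ S_n`. -/
def IsAnticommutative (μ : Mul F n L) : Prop :=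
  ∀ (σ : Equiv.Perm (Fin n)) (x : Fin n → L),
    μ (fun i => x (σ i)) = Equiv.Perm.sign σ • μ x

/-- A Filippov (`n`-Lie) algebra: anticommutative, and
`[[x_1, …, x_n], y_2, …, y_n] = ∑ i, [x_1, …, [x_i, y_2, …, y_n], …, x_n]`.
Here `p` is the first position, and the first entry of `y` is overwritten on both sides. -/
def IsFilippov (μ : Mul F n L) : Prop :=
  IsAnticommutative μ ∧
  ∀ (p : Fin n), (p : ℕ) = 0 → ∀ x y : Fin n → L,
    μ (Function.update y p (μ x)) =
      ∑ i, μ (Function.update x i (μ (Function.update y p (x i))))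

/-- Isomorphism of `n`-ary algebras. -/
def Iso (μ : Mul F n L) (μ' : Mul F n L') : Prop :=
  ∃ e : L ≃ₗ[F] L', ∀ x : Fin n → L, e (μ x) = μ' (fun i => e (x i))

/-- The space of quasiderivations: pairs `(d, f)` of linear maps with
`d [a_1, …, a_n] = ∑ i, [a_1, …, f a_i, …, a_n]`. -/
def QDer (μ : Mul F n L) : Submodule F (Module.End F L × Module.End F L) where
  carrier := {p | ∀ a : Fin n → L, p.1 (μ a) = ∑ i, μ (Function.update a i (p.2 (a i)))}
  zero_mem' := by
    intro a
    simp
  add_mem' := by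
    intro p q hp hq a
    simp only [Set.mem_ofPred_eq] at hp hq
    simp [hp a, hq a, Finset.sum_add_distrib]
  smul_mem' := by
    intro c p hp a
    simp only [Set.mem_ofPred_eq] at hp
    simp [hp a, Finset.smul_sum]

/-- Quasiderivations in the sense of Leger and Luks: the second components `f`. -/
def QDerLL (μ : Mul F n L) : Submodule F (Module.End F L) :=
  (QDer μ).map (LinearMap.snd F (Module.End F L) (Module.End F L))

/-- `x_1 · x_2 · … · x_n` (bracketed from the left) for a binary multiplication `m`;
the value for `n = 0` is a convention that is never used. -/
def iterProd (m : L →ₗ[F] L →ₗ[F] L) : {n : ℕ} → (Fin n → L) → L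
  | 0, _ => 0
  | 1, x => x 0
  | _ + 2, x => m (iterProd m (Fin.init x)) (x (Fin.last _))

end

section

variable (F : Type*) [Field F] (n : ℕ)

/-- The 1-dimensional algebra `L_α`, on `F` with `[1, …, 1] = α`. -/
noncomputable def Lalpha (α : F) : Mul F n F :=
  α • MultilinearMap.mkPiAlgebra F (Fin n) F

/-- The algebra `A_n` on `F^n`: `[x_1, …, x_n] = det(x_1, …, x_n) e_1`, the anticommutative
algebra with `[e_1, …, e_n] = e_1`. -/
noncomputable def algA : Mul F n (Fin n → F) :=
  (Matrix.detRowAlternating (R := F) (n := Fin n)).toMultilinearMap.smulRight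
    (fun k => if (k : ℕ) = 0 then 1 else 0)

variable {F n}

/-- The anticommutative algebra `L_B` on `F^(n+1)`, in which
`(-1)^(n+i+1) [e_1, …, ê_i, …, e_{n+1}] = e^i := ∑ k, β_{ki} e_k` for `i = 1, …, n+1`.
In coordinates `[x_1, …, x_n]` is the sum over `i` of the minor of the `n × (n+1)` matrix with
rows `x_1, …, x_n` that omits column `i`, times `(-1)^(n+i+1) e^i`.
The index `i` below starts from `0`, so the `i` of the formula is `i + 1`. -/
noncomputable def LB (B : Matrix (Fin (n + 1)) (Fin (n + 1)) F) :
    Mul F n (Fin (n + 1) → F) :=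
  ∑ i : Fin (n + 1),
    ((Matrix.detRowAlternating (R := F) (n := Fin n)).compLinearMap
      (LinearMap.funLeft F F i.succAbove)).toMultilinearMap.smulRight
        ((-1 : F) ^ (n + ((i : ℕ) + 1) + 1) • fun k => B k i)

variable (F n)

/-- The algebra `D_{n+1} = L_I`: `[e_1, …, ê_i, …, e_{n+1}] = (-1)^(n+i+1) e_i`
(see `algD_basis`). -/
noncomputable def algD : Mul F n (Fin (n + 1) → F) :=
  LB (1 : Matrix (Fin (n + 1)) (Fin (n + 1)) F)

end

section

variable {F : Type*} [Field F] {n : ℕ}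

theorem Lalpha_apply (α : F) (x : Fin n → F) : Lalpha F n α x = α * ∏ i, x i := by
  simp [Lalpha]

theorem algA_basis :
    algA F (n + 1) (fun i => Pi.single i 1) = Pi.single 0 1 := by
  have h : Matrix.det (fun i => Pi.single i 1 : Matrix (Fin (n + 1)) (Fin (n + 1)) F) = 1 := by
    refine Eq.trans (congrArg Matrix.det ?_) Matrix.det_one
    ext i j
    simp only [Matrix.one_apply, Pi.single_apply]
    exact if_congr eq_comm rfl rfl
  have h2 : algA F (n + 1) (fun i => Pi.single i 1) =
      Matrix.det (fun i => Pi.single i 1 : Matrix (Fin (n + 1)) (Fin (n + 1)) F) •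
        (fun k : Fin (n + 1) => if (k : ℕ) = 0 then (1 : F) else 0) := rfl
  rw [h2, h, one_smul]
  ext k
  simp only [Pi.single_apply, Fin.ext_iff]
  rfl

theorem algA_anticommutative : IsAnticommutative (algA F n) := by
  intro σ x
  have h := (Matrix.detRowAlternating (R := F) (n := Fin n)).map_perm x σ
  simp only [algA, MultilinearMap.smulRight_apply, AlternatingMap.coe_multilinearMap]
  rw [← smul_assoc, ← h]
  rfl

theorem LB_basis (B : Matrix (Fin (n + 1)) (Fin (n + 1)) F) (i : Fin (n + 1)) :
    (-1 : F) ^ (n + ((i : ℕ) + 1) + 1) • LB B (fun j => Pi.single (i.succAbove j) 1) =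
      fun k => B k i := by
  have key : ∀ j : Fin (n + 1),
      Matrix.det (fun a b => (Pi.single (i.succAbove a) 1 : Fin (n + 1) → F) (j.succAbove b)) =
        if j = i then 1 else 0 := by
    intro j
    split_ifs with hj
    · subst hj
      refine Eq.trans (congrArg Matrix.det ?_) Matrix.det_one
      ext a b
      simp only [Matrix.one_apply, Pi.single_apply, Fin.succAbove_right_inj]
      exact if_congr eq_comm rfl rfl
    · obtain ⟨a, rfl⟩ := Fin.exists_succAbove_eq hj
      refine Matrix.det_eq_zero_of_row_eq_zero a ?_
      intro b
      simp [Fin.succAbove_ne]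
  have h : LB B (fun j => Pi.single (i.succAbove j) 1) =
      ∑ j : Fin (n + 1), (if j = i then (1 : F) else 0) •
        ((-1 : F) ^ (n + ((j : ℕ) + 1) + 1) • fun k => B k j) := by
    simp only [LB, sum_apply, MultilinearMap.smulRight_apply]
    refine Finset.sum_congr rfl fun j _ => ?_
    rw [← key j]
    rfl
  rw [h]
  simp only [ite_smul, one_smul, zero_smul, Finset.sum_ite_eq', Finset.mem_univ, if_true]
  rw [smul_smul, ← mul_pow]
  simp

theorem LB_anticommutative (B : Matrix (Fin (n + 1)) (Fin (n + 1)) F) :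
    IsAnticommutative (LB B) := by
  intro σ x
  simp only [LB, sum_apply, MultilinearMap.smulRight_apply, Finset.smul_sum]
  refine Finset.sum_congr rfl fun i _ => ?_
  have h := AlternatingMap.map_perm ((Matrix.detRowAlternating (R := F) (n := Fin n)).compLinearMap
      (LinearMap.funLeft F F i.succAbove)) x σ
  refine (congrArg (fun c : F => c • ((-1 : F) ^ (n + ((i : ℕ) + 1) + 1) • fun k => B k i)) h).trans
    ?_
  exact smul_assoc _ _ _

theorem algD_basis (i : Fin (n + 1)) :
    algD F n (fun j => Pi.single (i.succAbove j) 1) =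
      (-1 : F) ^ (n + ((i : ℕ) + 1) + 1) • Pi.single i 1 := by
  have h := LB_basis (1 : Matrix (Fin (n + 1)) (Fin (n + 1)) F) i
  have h2 : (fun k => (1 : Matrix (Fin (n + 1)) (Fin (n + 1)) F) k i) = Pi.single i 1 := by
    ext k
    simp [Matrix.one_apply, Pi.single_apply]
  rw [h2] at h
  rw [← h, smul_smul, ← mul_pow]
  simp [algD]

end

end NAry

/-! Every endomorphism `f` has a companion `d`, and two choices of `f` carry the argument. If `f` is
elementary (one basis vector goes to another, the rest to `0`), a vanishing product of basis vectors
forces its neighbours to vanish. Hence a nonzero `μ` vanishes on no tuple of basis vectors, taken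
with distinct entries in the anticommutative case (`eq_zero_of_mul_basis_eq_zero`). If `f` is
diagonal, products of basis vectors are eigenvectors of `d` with eigenvalue the sum of the weights,
so products of different weight are independent (`linearIndependent_mul_basis`).

Counting independent products bounds `N = dim L`. In the commutative case `N ≥ 2` would give `N + 1`
of them. In the anticommutative case `N.choose n ≤ N`, so `N` is `n` or `n + 1`. For `N = n` the
product is a determinant times a fixed vector; for `N = n + 1` the independent products are, up to
sign, the columns of `B`.

For Filippov algebras, `algD` is the generalized cross product and `LB B = B ∘ algD`. The Filippov
identity makes `B` symmetric, hence congruent to `1` over an algebraically closed field, and a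
rescaled congruence is an isomorphism onto `algD`. -/

namespace NAry

/-! ### Consequences of every endomorphism being a quasiderivation. -/

section QuasiDerivations

variable {F : Type*} [Field F] {n : ℕ} {L : Type*} [AddCommGroup L] [Module F L]
  {μ : Mul F n L}

theorem exists_der_of_QDerLL_eq_top (hQ : QDerLL μ = ⊤) (f : Module.End F L) :
    ∃ d : Module.End F L, ∀ a : Fin n → L, d (μ a) = ∑ i, μ (Function.update a i (f (a i))) := by
  have h : f ∈ QDerLL μ := hQ ▸ Submodule.mem_top
  obtain ⟨⟨d, f'⟩, hp, rfl⟩ := h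
  exact ⟨d, hp⟩

theorem sum_update_eq_zero (hQ : QDerLL μ = ⊤) (f : Module.End F L) {a : Fin n → L}
    (ha : μ a = 0) : ∑ i, μ (Function.update a i (f (a i))) = 0 := by
  obtain ⟨d, hd⟩ := exists_der_of_QDerLL_eq_top hQ f
  rw [← hd, ha, map_zero]

/-- Products of basis vectors with pairwise different weights are linearly independent. -/
theorem linearIndependent_mul_basis (hQ : QDerLL μ = ⊤) {κ ι : Type*}
    (e : Module.Basis κ F L) (w : κ → F) (v : ι → Fin n → κ)
    (hinj : Function.Injective fun i => ∑ k, w (v i k))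
    (hne : ∀ i, μ (fun k => e (v i k)) ≠ 0) :
    LinearIndependent F fun i => μ (fun k => e (v i k)) := by
  obtain ⟨d, hd⟩ := exists_der_of_QDerLL_eq_top hQ (e.constr F fun i => w i • e i)
  refine Module.End.eigenvectors_linearIndependent' d (fun i => ∑ k, w (v i k)) hinj _ fun i => ?_
  refine ⟨Module.End.mem_eigenspace_iff.2 ?_, hne i⟩
  rw [hd, Finset.sum_smul]
  refine Finset.sum_congr rfl fun k _ => ?_
  rw [Module.Basis.constr_basis, MultilinearMap.map_update_smul, Function.update_eq_self]

end QuasiDerivations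

/-! ### Commutative algebras. -/

section Commutative

variable {F : Type*} [Field F] {n : ℕ} {L : Type*} [AddCommGroup L] [Module F L]
  {μ : Mul F n L}

/-- The elementary map `e (v k) ↦ e i` acts at every position where `v` repeats `v k`. By
commutativity all these terms agree, and characteristic `0` removes their number. -/
theorem IsCommutative.update_basis_eq_zero [CharZero F] (hμ : IsCommutative μ)
    (hQ : QDerLL μ = ⊤) {κ : Type*} (e : Module.Basis κ F L) {v : Fin n → κ}
    (hv : μ (fun k => e (v k)) = 0) (k : Fin n) (i : κ) :
    μ (fun l => e (Function.update v k i l)) = 0 := by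
  classical
  have h := sum_update_eq_zero hQ (e.constr F fun j => if j = v k then e i else 0) hv
  have h2 : ∀ l, μ (Function.update (fun k => e (v k)) l
      ((e.constr F fun j => if j = v k then e i else 0) (e (v l)))) =
      if v l = v k then μ (fun l => e (Function.update v k i l)) else 0 := by
    intro l
    rw [Module.Basis.constr_basis]
    split_ifs with hl
    · rw [← hμ (Equiv.swap k l)]
      congr 1
      ext m
      rcases eq_or_ne m k with rfl | hmk
      · simp
      rcases eq_or_ne m l with rfl | hml
      · rw [Equiv.swap_apply_right, Function.update_of_ne hmk]
        rcases eq_or_ne k m with rfl | hkm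
        · exact absurd rfl hmk
        · rw [Function.update_of_ne hkm, hl]
      · rw [Equiv.swap_apply_of_ne_of_ne hmk hml, Function.update_of_ne hmk,
          Function.update_of_ne hml]
    · exact μ.map_update_zero _ _
  rw [Finset.sum_congr rfl fun l _ => h2 l, ← Finset.sum_filter, Finset.sum_const,
    ← Nat.cast_smul_eq_nsmul F, smul_eq_zero] at h
  refine h.resolve_left ?_
  rw [← ne_eq, Nat.cast_ne_zero, Finset.card_ne_zero]
  exact ⟨k, by simp⟩

theorem IsCommutative.eq_zero_of_mul_basis_eq_zero [CharZero F] (hμ : IsCommutative μ)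
    (hQ : QDerLL μ = ⊤) {κ : Type*} [Finite κ] (e : Module.Basis κ F L) {v : Fin n → κ}
    (hv : μ (fun k => e (v k)) = 0) : μ = 0 := by
  classical
  have key : ∀ (w : Fin n → κ) (s : Finset (Fin n)), μ (fun k => e (s.piecewise w v k)) = 0 := by
    intro w s
    induction s using Finset.induction_on with
    | empty => simpa using hv
    | insert k s _ ih =>
      rw [Finset.piecewise_insert]
      exact hμ.update_basis_eq_zero hQ e ih k (w k)
  refine Module.Basis.ext_multilinear (fun _ => e) fun w => ?_
  simpa using key w Finset.univ

theorem IsCommutative.finrank_le_one [CharZero F] [FiniteDimensional F L] (hn : 2 ≤ n)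
    (hμ : IsCommutative μ) (hQ : QDerLL μ = ⊤) (h0 : μ ≠ 0) : Module.finrank F L ≤ 1 := by
  by_contra! hN
  let e := Module.finBasis F L
  let p : Fin n := ⟨0, by lia⟩
  -- With weight `i` on `e i`, the powers `[e i, …, e i]` have weights `n * i` and the extra product
  -- `[e 1, e 0, …, e 0]` has weight `1`, not a multiple of `n`.
  let v : Option (Fin (Module.finrank F L)) → Fin n → Fin (Module.finrank F L) := fun o =>
    o.elim (Function.update (fun _ => ⟨0, by lia⟩) p ⟨1, hN⟩) fun i _ => i
  have hs : ∀ i, ∑ k, ((v (some i) k : ℕ) : F) = ((n * i : ℕ) : F) := by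
    intro i
    simp [v]
  have hnone : ∑ k, ((v none k : ℕ) : F) = ((1 : ℕ) : F) := by
    rw [Finset.sum_eq_single p]
    · simp [v]
    · intro b _ hb
      simp [v, Function.update_of_ne hb]
    · simp
  have hli := linearIndependent_mul_basis hQ e (fun i => ((i : ℕ) : F)) v (by
    have h1 : ∀ i : ℕ, n * i ≠ 1 := fun i h => by
      have := Nat.dvd_one.1 ⟨i, h.symm⟩
      lia
    rintro (_ | i) (_ | j) hij
    · rfl
    · simp only [hnone, hs, Nat.cast_inj] at hij
      exact absurd hij.symm (h1 _)
    · simp only [hnone, hs, Nat.cast_inj] at hij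
      exact absurd hij (h1 _)
    · simp only [hs, Nat.cast_inj] at hij
      rw [Fin.ext (Nat.eq_of_mul_eq_mul_left (by lia) hij)])
    fun i h => h0 (hμ.eq_zero_of_mul_basis_eq_zero hQ e h)
  have := hli.fintype_card_le_finrank
  simp at this

theorem exists_iso_Lalpha_of_finrank_le_one [FiniteDimensional F L]
    (hL : Module.finrank F L ≤ 1) (h0 : μ ≠ 0) : ∃ α : F, α ≠ 0 ∧ Iso μ (Lalpha F n α) := by
  have hL1 : Module.finrank F L = 1 := by
    refine le_antisymm hL (Nat.one_le_iff_ne_zero.2 fun h => h0 ?_)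
    have := Module.finrank_zero_iff.1 h
    ext x
    exact Subsingleton.elim _ _
  let e : L ≃ₗ[F] F := LinearEquiv.ofFinrankEq L F (by simp [hL1])
  have hμ : ∀ x, e (μ x) = e (μ fun _ => e.symm 1) * ∏ i, e (x i) := by
    intro x
    have hx : x = fun i => e (x i) • e.symm 1 := by
      ext i
      rw [← map_smul, smul_eq_mul, mul_one, LinearEquiv.symm_apply_apply]
    conv_lhs => rw [hx]
    rw [MultilinearMap.map_smul_univ, map_smul, smul_eq_mul, mul_comm]
  refine ⟨e (μ fun _ => e.symm 1), fun h => h0 ?_, e, fun x => ?_⟩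
  · ext x
    apply e.injective
    simp [hμ x, h]
  · rw [Lalpha_apply, hμ]

theorem apply_iterProd {m : L →ₗ[F] L →ₗ[F] L} (e : L →ₗ[F] F)
    (h : ∀ x y, e (m x y) = e x * e y) :
    ∀ {n : ℕ} (_ : n ≠ 0) (x : Fin n → L), e (iterProd m x) = ∏ i, e (x i)
  | 0, h0, _ => absurd rfl h0
  | 1, _, x => by simp [iterProd]
  | n + 2, _, x => by
    rw [iterProd, h, apply_iterProd e h (Nat.succ_ne_zero n), Fin.prod_univ_castSucc (n := n + 1)]
    rfl

theorem Iso.exists_mul_eq_iterProd [IsAlgClosed F] (hn : 2 ≤ n) {α : F} (hα : α ≠ 0)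
    (h : Iso μ (Lalpha F n α)) :
    ∃ m : L →ₗ[F] L →ₗ[F] L, (∃ e : L ≃ₗ[F] F, ∀ x y : L, e (m x y) = e x * e y) ∧
      ∀ x : Fin n → L, μ x = iterProd m x := by
  obtain ⟨e, he⟩ := h
  -- Rescaling the coordinate by `β` turns the constant `α` into `α * β / β ^ n = 1`.
  obtain ⟨β, hβ⟩ := IsAlgClosed.exists_pow_nat_eq α (show 0 < n - 1 by lia)
  have hβ0 : β ≠ 0 := by
    rintro rfl
    rw [zero_pow (by lia)] at hβ
    exact hα hβ.symm
  let e' : L ≃ₗ[F] F := e.trans (LinearEquiv.smulOfNeZero F F β hβ0)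
  have he' : ∀ x, e' x = β * e x := fun x => rfl
  let m : L →ₗ[F] L →ₗ[F] L :=
    ((LinearMap.mul F F).compl₁₂ e'.toLinearMap e'.toLinearMap).compr₂ e'.symm.toLinearMap
  have hm : ∀ x y, e' (m x y) = e' x * e' y := fun x y => by simp [m]
  refine ⟨m, ⟨e', hm⟩, fun x => e'.injective ?_⟩
  have h1 := apply_iterProd e'.toLinearMap hm (show n ≠ 0 by lia) x
  simp only [LinearEquiv.coe_coe] at h1
  rw [h1, he', he, Lalpha_apply, ← hβ, ← mul_assoc, ← pow_succ', Nat.sub_add_cancel (by lia)]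
  simp [he', Finset.prod_mul_distrib]

end Commutative

end NAry

/-! ### Anticommutative algebras: dimension and classification. -/

namespace NAry

theorem lt_choose {N n : ℕ} (hn : 2 ≤ n) (hN : n + 2 ≤ N) : N < N.choose n := by
  induction N generalizing n with
  | zero => lia
  | succ N ih =>
    obtain ⟨m, rfl⟩ : ∃ m, n = m + 1 := ⟨n - 1, by lia⟩
    rw [Nat.choose_succ_succ]
    rcases Nat.lt_or_ge N (m + 1 + 2) with h | h
    · obtain rfl : N = m + 2 := by lia
      have h1 : (m + 2).choose (m + 1) = m + 2 := Nat.choose_succ_self_right _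
      rcases Nat.lt_or_ge m 2 with h2 | h2
      · obtain rfl : m = 1 := by lia
        decide
      · have := ih h2 le_rfl
        lia
    · have h1 := ih hn h
      have h2 : 0 < N.choose m := Nat.choose_pos (by lia)
      lia

theorem exists_succAbove_comp_perm {n : ℕ} {v : Fin n → Fin (n + 1)}
    (hv : Function.Injective v) :
    ∃ (i : Fin (n + 1)) (σ : Equiv.Perm (Fin n)), v = fun k => i.succAbove (σ k) := by
  obtain ⟨i, hi⟩ : ∃ i, ∀ k, v k ≠ i := by
    by_contra! h
    have := Fintype.card_le_of_surjective v h
    simp at this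
  choose s hs using fun k => Fin.exists_succAbove_eq (hi k)
  have hinj : Function.Injective s := fun a b hab => hv (by rw [← hs a, ← hs b, hab])
  exact ⟨i, Equiv.ofBijective s (Finite.injective_iff_bijective.1 hinj),
    funext fun k => (hs k).symm⟩

section Anticommutative

variable {F : Type*} [Field F] {n : ℕ} {L : Type*} [AddCommGroup L] [Module F L]
  {μ : Mul F n L}

theorem IsAnticommutative.map_eq_zero_of_eq [CharZero F] (hμ : IsAnticommutative μ)
    (x : Fin n → L) (i j : Fin n) (h : x i = x j) (hij : i ≠ j) : μ x = 0 := by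
  have h1 := hμ (Equiv.swap i j) x
  have h2 : (fun k => x (Equiv.swap i j k)) = x := by
    ext k
    rw [Equiv.swap_apply_def]
    split_ifs with h1 h2
    · rw [h1, h]
    · rw [h2, h]
    · rfl
  rw [h2, Equiv.Perm.sign_swap hij, Units.neg_smul, one_smul, eq_neg_iff_add_eq_zero,
    ← two_smul F] at h1
  exact (smul_eq_zero.1 h1).resolve_left two_ne_zero

/-- The alternating map underlying an anticommutative multiplication. -/
def IsAnticommutative.toAlternatingMap [CharZero F] (hμ : IsAnticommutative μ) :
    L [⋀^Fin n]→ₗ[F] L :=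
  { μ with map_eq_zero_of_eq' := hμ.map_eq_zero_of_eq }

theorem IsAnticommutative.ext_basis [CharZero F] (hμ : IsAnticommutative μ) {L' : Type*}
    [AddCommGroup L'] [Module F L'] {μ' : Mul F n L'} (hμ' : IsAnticommutative μ')
    {κ : Type*} (b : Module.Basis κ F L) (e : L →ₗ[F] L')
    (h : ∀ v : Fin n → κ, Function.Injective v →
      e (μ fun k => b (v k)) = μ' fun k => e (b (v k))) (x : Fin n → L) :
    e (μ x) = μ' fun k => e (x k) := by
  have : e.compAlternatingMap hμ.toAlternatingMap = hμ'.toAlternatingMap.compLinearMap e :=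
    b.ext_alternating h
  exact congrArg (fun f : L [⋀^Fin n]→ₗ[F] L' => f x) this

theorem IsAnticommutative.update_basis_eq_zero (hQ : QDerLL μ = ⊤) {κ : Type*}
    (e : Module.Basis κ F L) {v : Fin n → κ} (hinj : Function.Injective v)
    (hv : μ (fun k => e (v k)) = 0) (k : Fin n) (i : κ) :
    μ (fun l => e (Function.update v k i l)) = 0 := by
  classical
  have h := sum_update_eq_zero hQ (e.constr F fun j => if j = v k then e i else 0) hv
  rw [Finset.sum_eq_single k] at h
  · rw [Module.Basis.constr_basis, if_pos rfl] at h
    rw [← h]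
    congr 1
    ext l
    exact Function.apply_update (fun _ => e) v k i l
  · intro l _ hl
    rw [Module.Basis.constr_basis, if_neg (hinj.ne hl)]
    exact μ.map_update_zero _ _
  · simp

/-- Induction on the number of positions where `v` differs from a target `w`. The wanted entry `w k`
is swapped into place if `v` already contains it, and substituted otherwise; `v` stays injective. -/
theorem IsAnticommutative.eq_zero_of_mul_basis_eq_zero [CharZero F]
    (hμ : IsAnticommutative μ) (hQ : QDerLL μ = ⊤) {κ : Type*} (e : Module.Basis κ F L)
    {v : Fin n → κ} (hinj : Function.Injective v) (hv : μ (fun k => e (v k)) = 0) : μ = 0 := by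
  classical
  have key : ∀ (w : Fin n → κ), Function.Injective w → ∀ (m : ℕ) (v : Fin n → κ),
      (Finset.univ.filter fun k => v k ≠ w k).card = m → Function.Injective v →
      μ (fun k => e (v k)) = 0 → μ (fun k => e (w k)) = 0 := by
    intro w hw m
    induction m using Nat.strong_induction_on with
    | _ m ih =>
    intro v hm hinj hv
    by_cases hvw : ∀ k, v k = w k
    · rwa [funext hvw] at hv
    push Not at hvw
    obtain ⟨k, hk⟩ := hvw
    by_cases hr : ∃ l, v l = w k
    · obtain ⟨l, hl⟩ := hr
      have hlk : l ≠ k := by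
        rintro rfl
        exact hk hl
      refine ih _ ?_ (fun i => v (Equiv.swap k l i)) rfl (hinj.comp (Equiv.injective _)) ?_
      · rw [← hm]
        refine Finset.card_lt_card (Finset.ssubset_iff_of_subset ?_ |>.2
          ⟨k, by simpa using hk, by simp [hl]⟩)
        intro i hi
        simp only [Finset.mem_filter_univ] at hi ⊢
        rcases eq_or_ne i k with rfl | hik
        · exact hk
        rcases eq_or_ne i l with rfl | hil
        · rw [hl]
          exact hw.ne hik.symm
        · rwa [Equiv.swap_apply_of_ne_of_ne hik hil] at hi
      · have := hμ (Equiv.swap k l) fun k => e (v k)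
        rw [this, hv, smul_zero]
    · push Not at hr
      refine ih _ ?_ (Function.update v k (w k)) rfl ?_
        (IsAnticommutative.update_basis_eq_zero hQ e hinj hv k (w k))
      · rw [← hm]
        refine Finset.card_lt_card (Finset.ssubset_iff_of_subset ?_ |>.2
          ⟨k, by simpa using hk, by simp⟩)
        intro i hi
        simp only [Finset.mem_filter_univ] at hi ⊢
        rcases eq_or_ne i k with rfl | hik
        · exact hk
        · rwa [Function.update_of_ne hik] at hi
      · intro a b hab
        rcases eq_or_ne a k with ha | ha <;> rcases eq_or_ne b k with hb | hb
        · rw [ha, hb]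
        · rw [ha, Function.update_self, Function.update_of_ne hb] at hab
          exact absurd hab.symm (hr b)
        · rw [hb, Function.update_self, Function.update_of_ne ha] at hab
          exact absurd hab (hr a)
        · rw [Function.update_of_ne ha, Function.update_of_ne hb] at hab
          exact hinj hab
  have := hμ.ext_basis (μ' := (0 : Mul F n L)) (fun _ _ => by simp) e LinearMap.id
    fun w hw => by simpa using key w hw _ v rfl hinj hv
  ext x
  simpa using this x

theorem IsAnticommutative.linearIndependent_mul_basis [CharZero F] (hμ : IsAnticommutative μ)
    (hQ : QDerLL μ = ⊤) (h0 : μ ≠ 0) {N : ℕ} (e : Module.Basis (Fin N) F L) {ι : Type*}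
    (v : ι → Fin n → Fin N) (hv : ∀ i, Function.Injective (v i))
    (hinj : Function.Injective fun i => Finset.univ.image (v i)) :
    LinearIndependent F fun i => μ (fun k => e (v i k)) := by
  -- Weights `2 ^ i` separate index sets by uniqueness of binary expansions.
  refine NAry.linearIndependent_mul_basis hQ e (fun i => ((2 ^ (i : ℕ) : ℕ) : F)) v ?_
    fun i h => h0 (hμ.eq_zero_of_mul_basis_eq_zero hQ e (hv i) h)
  intro i j hij
  simp only [← Nat.cast_sum, Nat.cast_inj] at hij
  have hs : ∀ i, ∑ k, 2 ^ (v i k : ℕ) =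
      ∑ m ∈ (Finset.univ.image (v i)).map Fin.valEmbedding, 2 ^ m := by
    intro i
    rw [Finset.sum_map, Finset.sum_image (hv i).injOn]
    rfl
  rw [hs, hs] at hij
  exact hinj (Finset.map_injective _ (Finset.geomSum_injective le_rfl hij))

theorem IsAnticommutative.finrank_eq [CharZero F] [FiniteDimensional F L] (hn : 2 ≤ n)
    (hμ : IsAnticommutative μ) (hQ : QDerLL μ = ⊤) (h0 : μ ≠ 0) :
    Module.finrank F L = n ∨ Module.finrank F L = n + 1 := by
  let e := Module.finBasis F L
  have hle : n ≤ Module.finrank F L := by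
    by_contra! h
    refine h0 ?_
    have := hμ.ext_basis (μ' := (0 : Mul F n L)) (fun _ _ => by simp) e LinearMap.id
      fun w hw => by
        have := Fintype.card_le_of_injective w hw
        simp only [Fintype.card_fin] at this
        lia
    ext x
    simpa using this x
  have hli := hμ.linearIndependent_mul_basis hQ h0 e
    (fun S : {S : Finset (Fin (Module.finrank F L)) // S.card = n} => S.1.orderEmbOfFin S.2)
    (fun S => (S.1.orderEmbOfFin S.2).injective) (fun S T h => by
      simp only [Finset.image_orderEmbOfFin_univ] at h
      exact Subtype.ext h)
  have hc := hli.fintype_card_le_finrank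
  rw [Fintype.card_finset_len, Fintype.card_fin] at hc
  by_contra! h
  have := lt_choose hn (show n + 2 ≤ Module.finrank F L by lia)
  lia

theorem exists_basis_apply_eq {N : ℕ} (b : Module.Basis (Fin N) F L) {w : L} (hw : w ≠ 0)
    (p : Fin N) : ∃ b' : Module.Basis (Fin N) F L, b' p = w := by
  classical
  have hli : LinearIndepOn F id {w} := (linearIndepOn_singleton_iff F).2 hw
  let c := Module.Basis.extend hli
  let σ := c.indexEquiv b
  let q : hli.extend (Set.subset_univ _) :=
    ⟨w, hli.subset_extend _ rfl⟩
  refine ⟨c.reindex (σ.trans (Equiv.swap (σ q) p)), ?_⟩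
  have : (σ.trans (Equiv.swap (σ q) p)).symm p = q := by
    rw [Equiv.symm_apply_eq]
    simp
  rw [Module.Basis.reindex_apply, this]
  exact Module.Basis.extend_apply_self hli q

theorem IsAnticommutative.iso_algA [CharZero F] (hn : 2 ≤ n) (hμ : IsAnticommutative μ)
    (h0 : μ ≠ 0) (b₀ : Module.Basis (Fin n) F L) : Iso μ (algA F n) := by
  have hall : ∀ b : Module.Basis (Fin n) F L, ∀ {w : L},
      μ b = w → ∀ x, μ x = b.det x • w := by
    intro b w hw x
    have h := congrArg (fun f : L [⋀^Fin n]→ₗ[F] L => f x)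
      (b.ext_alternating (f := hμ.toAlternatingMap)
        (g := (LinearMap.toSpanSingleton F L w).compAlternatingMap b.det) fun v hv => by
          have hσ := Finite.injective_iff_bijective.1 hv
          have h1 := hμ.toAlternatingMap.map_perm b (Equiv.ofBijective v hσ)
          have h2 := b.det.map_perm b (Equiv.ofBijective v hσ)
          refine h1.trans ?_
          refine Eq.trans ?_ (congrArg (fun c : F => c • w) h2).symm
          rw [b.det_self, smul_assoc, one_smul]
          exact congrArg _ hw)
    exact h
  have hw0 : μ b₀ ≠ 0 := fun h => h0 (by
    ext x
    rw [hall b₀ h]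
    simp)
  let p : Fin n := ⟨0, by lia⟩
  let q : Fin n := ⟨1, hn⟩
  have hpq : p ≠ q := by simp [p, q]
  obtain ⟨b, hb⟩ := exists_basis_apply_eq b₀ hw0 p
  have hc : b₀.det b ≠ 0 := (b₀.isUnit_det b).ne_zero
  -- Rescaling a vector other than `b p` normalizes the determinant and keeps `b p = μ b₀`; this
  -- needs `n ≥ 2`.
  let b' := b.unitsSMul (Function.update 1 q (Units.mk0 _ hc)⁻¹)
  have hb'p : b' p = μ b₀ := by
    simp [b', Module.Basis.unitsSMul_apply, Function.update_of_ne hpq, hb]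
  have hb' : μ b' = b' p := by
    rw [hb'p, hall b₀ rfl]
    have : (b' : Fin n → L) = fun i =>
        (((Function.update 1 q (Units.mk0 _ hc)⁻¹ : Fin n → Fˣ) i : Fˣ) : F) • b i := by
      ext i
      exact Module.Basis.unitsSMul_apply i
    rw [this, AlternatingMap.map_smul_univ, Finset.prod_eq_single q]
    · simp [hc]
    · intro i _ hi
      simp [Function.update_of_ne hi]
    · simp
  refine ⟨b'.equivFun, fun x => ?_⟩
  rw [hall b' hb', map_smul]
  have h1 : algA F n (fun i => b'.equivFun (x i)) =
      Matrix.det (fun i => b'.equivFun (x i)) •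
        (fun k : Fin n => if (k : ℕ) = 0 then (1 : F) else 0) := rfl
  rw [h1, Module.Basis.det_apply, ← Matrix.det_transpose]
  congr 1
  ext k
  simp [Module.Basis.equivFun_self, p, Fin.ext_iff, eq_comm]

theorem IsAnticommutative.exists_iso_LB [CharZero F] (hμ : IsAnticommutative μ)
    (hQ : QDerLL μ = ⊤) (h0 : μ ≠ 0) (b : Module.Basis (Fin (n + 1)) F L) :
    ∃ B : Matrix (Fin (n + 1)) (Fin (n + 1)) F, B.det ≠ 0 ∧ Iso μ (LB B) := by
  let c : Fin (n + 1) → F := fun i => (-1) ^ (n + ((i : ℕ) + 1) + 1)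
  have hcc : ∀ i, c i * c i = 1 := fun i => by
    rw [← mul_pow]
    simp
  let B : Matrix (Fin (n + 1)) (Fin (n + 1)) F :=
    fun k i => b.equivFun (c i • μ fun j => b (i.succAbove j)) k
  have hLB : ∀ i : Fin (n + 1), b.equivFun (μ fun j => b (i.succAbove j)) =
      LB B fun j => b.equivFun (b (i.succAbove j)) := by
    intro i
    have h1 : (fun j => b.equivFun (b (i.succAbove j))) =
        fun j => Pi.single (i.succAbove j) (1 : F) := by
      ext j k
      simp [Module.Basis.equivFun_self, Pi.single_apply, eq_comm]
    have h2 : c i • b.equivFun (μ fun j => b (i.succAbove j)) =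
        c i • LB B fun j => b.equivFun (b (i.succAbove j)) := by
      rw [h1, LB_basis, ← map_smul]
    have h3 := congrArg (fun z => c i • z) h2
    simpa only [smul_smul, hcc, one_smul] using h3
  refine ⟨B, ?_, b.equivFun, hμ.ext_basis (LB_anticommutative B) b b.equivFun.toLinearMap ?_⟩
  · have hli := hμ.linearIndependent_mul_basis hQ h0 b (fun i : Fin (n + 1) => i.succAbove)
      (fun i => Fin.succAbove_right_injective) (by
        intro i j h
        have : i ∉ Finset.univ.image i.succAbove := by simp
        simp only at h
        rw [h] at this
        by_contra hij
        obtain ⟨k, hk⟩ := Fin.exists_succAbove_eq hij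
        exact this (by simp [← hk]))
    have hc0 : ∀ i, c i ≠ 0 := fun i h => by simpa [h] using hcc i
    have h2 := (hli.units_smul fun i => Units.mk0 (c i) (hc0 i)).map' b.equivFun.toLinearMap
      b.equivFun.ker
    have h3 : LinearIndependent F B.col := h2
    rw [Matrix.linearIndependent_cols_iff_isUnit, Matrix.isUnit_iff_isUnit_det] at h3
    exact h3.ne_zero
  · intro v hv
    obtain ⟨i, σ, rfl⟩ := exists_succAbove_comp_perm hv
    have h1 := hμ σ fun j => b (i.succAbove j)
    have h2 := LB_anticommutative B σ fun j => b.equivFun (b (i.succAbove j))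
    simp only [LinearEquiv.coe_coe]
    rw [h1, h2, ← hLB]
    exact map_zsmul b.equivFun ((Equiv.Perm.sign σ : ℤˣ) : ℤ) _

end Anticommutative

end NAry

/-! ### Determinants, congruence and the generalized cross product. -/

namespace NAry

/-- By Cramer's rule each summand is a diagonal entry of `M * Dᵀ * adj M`; the trace is cyclic. -/
theorem _root_.Matrix.sum_det_updateRow_mulVec {R ι : Type*} [CommRing R] [Fintype ι]
    [DecidableEq ι] (M D : Matrix ι ι R) :
    ∑ i, (M.updateRow i (D.mulVec (M i))).det = D.trace * M.det := by
  have h : ∀ i, (M.updateRow i (D.mulVec (M i))).det = (M * D.transpose * M.adjugate) i i := by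
    intro i
    rw [← Matrix.cramer_transpose_apply, Matrix.cramer_eq_adjugate_mulVec,
      ← Matrix.adjugate_transpose, Matrix.mulVec_transpose, Matrix.mul_apply_eq_vecMul,
      Matrix.mul_apply_eq_vecMul, Matrix.vecMul_transpose]
  calc ∑ i, (M.updateRow i (D.mulVec (M i))).det = (M * D.transpose * M.adjugate).trace :=
        Finset.sum_congr rfl fun i _ => h i
    _ = (D.transpose * (M.adjugate * M)).trace := by
        rw [Matrix.mul_assoc, Matrix.trace_mul_comm, Matrix.mul_assoc]
    _ = D.trace * M.det := by
        rw [Matrix.adjugate_mul, Matrix.mul_smul, Matrix.mul_one, Matrix.trace_smul,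
          Matrix.trace_transpose, smul_eq_mul, mul_comm]

/-- A symmetric matrix over an algebraically closed field that is invertible is congruent to the
identity matrix. -/
theorem _root_.Matrix.exists_mul_mul_transpose_eq_one {F : Type*} [Field F] [CharZero F]
    [IsAlgClosed F] {ι : Type*} [Fintype ι] [DecidableEq ι] {B : Matrix ι ι F}
    (hB : B.transpose = B) (hdet : B.det ≠ 0) :
    ∃ T : Matrix ι ι F, T * B * T.transpose = 1 := by
  let β : LinearMap.BilinForm F (ι → F) := Matrix.toBilin' B
  have hβ : β.IsSymm := ⟨fun x y => by
    simp only [β, Matrix.toBilin'_apply']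
    rw [dotProduct_comm, ← Matrix.vecMul_transpose, hB, Matrix.dotProduct_mulVec]⟩
  let _ : Invertible (2 : F) := invertibleOfNonzero two_ne_zero
  obtain ⟨v, hv⟩ := LinearMap.BilinForm.exists_orthogonal_basis (LinearMap.BilinForm.isSymm_iff.1 hβ)
  let b := v.reindex (finCongr (Module.finrank_fintype_fun_eq_card F) |>.trans
    (Fintype.equivFin ι).symm)
  have hb : ∀ i j, i ≠ j → β (b i) (b j) = 0 := by
    intro i j hij
    simp only [b, Module.Basis.reindex_apply]
    exact hv (by simpa using hij)
  let P : Matrix ι ι F := (Pi.basisFun F ι).toMatrix b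
  have hP : P.transpose * B * P = LinearMap.BilinForm.toMatrix b β := by
    rw [← LinearMap.BilinForm.toMatrix_mul_basis_toMatrix (Pi.basisFun F ι) b β]
    congr 2
    ext i j
    simp [β, LinearMap.BilinForm.toMatrix_apply, Matrix.toBilin'_single]
  have hdiag : P.transpose * B * P = Matrix.diagonal fun i => β (b i) (b i) := by
    rw [hP]
    ext i j
    rw [LinearMap.BilinForm.toMatrix_apply, Matrix.diagonal_apply]
    split_ifs with h
    · rw [h]
    · exact hb i j h
  have hPdet : P.det ≠ 0 := by
    have := (Pi.basisFun F ι).isUnit_det b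
    rw [Module.Basis.det_apply] at this
    exact this.ne_zero
  have hne : ∀ i, β (b i) (b i) ≠ 0 := by
    have : (P.transpose * B * P).det ≠ 0 := by
      rw [Matrix.det_mul, Matrix.det_mul, Matrix.det_transpose]
      exact mul_ne_zero (mul_ne_zero hPdet hdet) hPdet
    rw [hdiag, Matrix.det_diagonal, Finset.prod_ne_zero_iff] at this
    exact fun i => this i (Finset.mem_univ i)
  choose r hr using fun i => IsAlgClosed.exists_pow_nat_eq (β (b i) (b i)) (n := 2) two_pos
  have hr0 : ∀ i, r i ≠ 0 := fun i h => hne i (by rw [← hr, h, zero_pow two_ne_zero])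
  refine ⟨Matrix.diagonal (fun i => (r i)⁻¹) * P.transpose, ?_⟩
  rw [Matrix.transpose_mul, Matrix.transpose_transpose, Matrix.diagonal_transpose]
  calc _ = Matrix.diagonal (fun i => (r i)⁻¹) * (P.transpose * B * P) *
        Matrix.diagonal (fun i => (r i)⁻¹) := by simp only [Matrix.mul_assoc]
    _ = 1 := by
      rw [hdiag, Matrix.diagonal_mul_diagonal, Matrix.diagonal_mul_diagonal, ← Matrix.diagonal_one]
      congr 1
      ext i
      rw [← hr i]
      have := hr0 i
      field_simp

section LB

variable {F : Type*} [Field F] {n : ℕ}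

theorem LB_eq_mulVec (B : Matrix (Fin (n + 1)) (Fin (n + 1)) F) (x : Fin n → Fin (n + 1) → F) :
    LB B x = B.mulVec (algD F n x) := by
  ext k
  simp only [algD, LB, sum_apply, MultilinearMap.smulRight_apply, Matrix.mulVec, dotProduct,
    Finset.sum_apply, Pi.smul_apply, smul_eq_mul, Matrix.one_apply, mul_ite, mul_one, mul_zero,
    Finset.sum_ite_eq, Finset.mem_univ, if_true]
  exact Finset.sum_congr rfl fun i _ => by ring

/-- Laplace expansion along the last row; this turns identities for `algD` into determinant
identities. -/
theorem algD_dotProduct (x : Fin n → Fin (n + 1) → F) (y : Fin (n + 1) → F) :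
    algD F n x ⬝ᵥ y = (Matrix.of (Fin.snoc x y : Fin (n + 1) → Fin (n + 1) → F)).det := by
  rw [Matrix.det_succ_row _ (Fin.last n)]
  simp only [algD, LB, sum_apply, MultilinearMap.smulRight_apply, dotProduct,
    Finset.sum_apply, Pi.smul_apply, smul_eq_mul, Matrix.one_apply, mul_ite, mul_one, mul_zero,
    Finset.sum_ite_eq, Finset.mem_univ, if_true]
  refine Finset.sum_congr rfl fun i _ => ?_
  have h1 : (Matrix.submatrix (Matrix.of (Fin.snoc x y : Fin (n + 1) → Fin (n + 1) → F))
      (Fin.last n).succAbove i.succAbove) = fun a b => x a (i.succAbove b) := by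
    ext a b
    simp [Matrix.submatrix_apply]
  rw [h1]
  simp only [Matrix.of_apply, Fin.snoc_last, Fin.val_last]
  have h2 : (-1 : F) ^ (n + ((i : ℕ) + 1) + 1) = (-1) ^ (n + (i : ℕ)) := by
    rw [← add_assoc, pow_succ, pow_succ]
    ring
  rw [h2]
  have h3 : ((Matrix.detRowAlternating (R := F) (n := Fin n)).compLinearMap
      (LinearMap.funLeft F F i.succAbove)).toMultilinearMap x =
      Matrix.det fun a b => x a (i.succAbove b) := rfl
  rw [h3]
  ring

theorem transpose_mulVec_algD (T : Matrix (Fin (n + 1)) (Fin (n + 1)) F)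
    (x : Fin n → Fin (n + 1) → F) :
    T.transpose.mulVec (algD F n fun i => T.mulVec (x i)) = T.det • algD F n x := by
  refine dotProduct_eq _ _ fun y => ?_
  rw [Matrix.mulVec_transpose, ← Matrix.dotProduct_mulVec, smul_dotProduct, algD_dotProduct,
    algD_dotProduct, smul_eq_mul, mul_comm, ← Matrix.det_transpose T, ← Matrix.det_mul]
  congr 1
  ext i j
  rw [Matrix.mul_apply_eq_vecMul, Matrix.vecMul_transpose]
  change _ = T.mulVec ((Fin.snoc x y : Fin (n + 1) → Fin (n + 1) → F) i) j
  refine Fin.lastCases ?_ (fun i => ?_) i <;> simp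

theorem iso_LB_algD_of_congr_one [IsAlgClosed F] (hn : 2 ≤ n)
    {B T : Matrix (Fin (n + 1)) (Fin (n + 1)) F} (h : T * B * T.transpose = 1) :
    Iso (LB B) (algD F n) := by
  have hT : T.det ≠ 0 := by
    intro h0
    have := congrArg Matrix.det h
    simp [h0] at this
  -- For `e = s • T` the two sides differ by the factors `s` and `s ^ n * T.det`.
  obtain ⟨s, hs⟩ := IsAlgClosed.exists_pow_nat_eq (T.det)⁻¹ (show 0 < n - 1 by lia)
  have hs0 : s ≠ 0 := by
    rintro rfl
    rw [zero_pow (by lia)] at hs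
    exact inv_ne_zero hT hs.symm
  let e : (Fin (n + 1) → F) ≃ₗ[F] (Fin (n + 1) → F) :=
    (Matrix.toLinearEquiv' T (Matrix.invertibleOfIsUnitDet T hT.isUnit)).trans
      (LinearEquiv.smulOfNeZero F _ s hs0)
  have he : ∀ x, e x = s • T.mulVec x := fun x => rfl
  refine ⟨e, fun x => ?_⟩
  simp only [he]
  have h1 : algD F n (fun i => s • T.mulVec (x i)) =
      s ^ n • algD F n fun i => T.mulVec (x i) := by
    rw [MultilinearMap.map_smul_univ]
    simp
  have h2 : algD F n (fun i => T.mulVec (x i)) = T.det • T.mulVec (B.mulVec (algD F n x)) := by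
    rw [← Matrix.mulVec_smul, ← Matrix.mulVec_smul, ← transpose_mulVec_algD, Matrix.mulVec_mulVec,
      Matrix.mulVec_mulVec, h, Matrix.one_mulVec]
  obtain ⟨m, rfl⟩ : ∃ m, n = m + 1 := ⟨n - 1, by lia⟩
  rw [h1, h2, ← LB_eq_mulVec, smul_smul, pow_succ]
  rw [Nat.add_sub_cancel] at hs
  rw [hs]
  congr 1
  field_simp

theorem sum_algD_update (D : Matrix (Fin (n + 1)) (Fin (n + 1)) F)
    (x : Fin n → Fin (n + 1) → F) (z : Fin (n + 1) → F) :
    ∑ i, algD F n (Function.update x i (D.mulVec (x i))) ⬝ᵥ z + algD F n x ⬝ᵥ D.mulVec z =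
      D.trace * algD F n x ⬝ᵥ z := by
  have h := Matrix.sum_det_updateRow_mulVec
    (Matrix.of (Fin.snoc x z : Fin (n + 1) → Fin (n + 1) → F)) D
  rw [Fin.sum_univ_castSucc] at h
  rw [algD_dotProduct, algD_dotProduct, ← h]
  congr 1
  · refine Finset.sum_congr rfl fun i _ => ?_
    have h1 : (Fin.snoc x z : Fin (n + 1) → Fin (n + 1) → F) i.castSucc = x i :=
      Fin.snoc_castSucc ..
    rw [algD_dotProduct, Fin.snoc_update, ← h1]
    rfl
  · have h1 : (Fin.snoc x (D.mulVec z) : Fin (n + 1) → Fin (n + 1) → F) =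
        Function.update (Fin.snoc x z) (Fin.last n)
          (D.mulVec ((Fin.snoc x z : Fin (n + 1) → Fin (n + 1) → F) (Fin.last n))) := by
      rw [Fin.snoc_last, Fin.update_snoc_last]
    rw [h1]
    rfl

theorem eq_of_algD_dotProduct_eq {u w : Fin (n + 1) → F}
    (h : ∀ x, algD F n x ⬝ᵥ u = algD F n x ⬝ᵥ w) : u = w := by
  ext i
  have h1 := h fun j => Pi.single (i.succAbove j) 1
  rw [algD_basis, smul_dotProduct, smul_dotProduct, single_one_dotProduct,
    single_one_dotProduct, smul_eq_mul, smul_eq_mul] at h1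
  exact mul_left_cancel₀ (pow_ne_zero _ (neg_ne_zero.2 one_ne_zero)) h1

theorem eq_zero_of_mulVec_algD_eq_zero {M : Matrix (Fin (n + 1)) (Fin (n + 1)) F}
    (h : ∀ x, M.mulVec (algD F n x) = 0) : M = 0 := by
  rw [← Matrix.transpose_eq_zero]
  apply Matrix.mulVec_injective
  ext u : 1
  rw [Matrix.zero_mulVec]
  refine eq_of_algD_dotProduct_eq fun x => ?_
  rw [Matrix.dotProduct_mulVec, Matrix.vecMul_transpose, h, zero_dotProduct, dotProduct_zero]

theorem algD_update_dotProduct_comm [CharZero F] (y : Fin n → Fin (n + 1) → F) (p : Fin n)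
    (u z : Fin (n + 1) → F) :
    algD F n (Function.update y p u) ⬝ᵥ z = -(algD F n (Function.update y p z) ⬝ᵥ u) := by
  rw [algD_dotProduct, algD_dotProduct]
  have hp : p.castSucc ≠ Fin.last n := (Fin.castSucc_lt_last p).ne
  have h : (Matrix.of (Fin.snoc (Function.update y p u) z : Fin (n + 1) → Fin (n + 1) → F)) =
      (Matrix.of (Fin.snoc (Function.update y p z) u : Fin (n + 1) → Fin (n + 1) → F)).submatrix
        (Equiv.swap p.castSucc (Fin.last n)) id := by
    ext i j
    rw [Matrix.submatrix_apply, Matrix.of_apply, Matrix.of_apply]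
    refine Fin.lastCases ?_ (fun i => ?_) i
    · simp
    · rcases eq_or_ne i p with rfl | hi
      · simp
      · rw [Equiv.swap_apply_of_ne_of_ne (by simpa using hi) (Fin.castSucc_lt_last i).ne]
        simp [hi]
  rw [h, Matrix.det_permute, Equiv.Perm.sign_swap hp]
  simp

/-- The operator `D : u ↦ [u, y₂, …, yₙ]` is a derivation. Comparing the Filippov identity, after
cancelling `B`, with the trace identity `sum_algD_update` shows that `B - Bᵀ` sends `algD (z, y₂, …,
yₙ)` to `D.trace • z`. -/
theorem IsFilippov.transpose_eq [CharZero F] (hn : 2 ≤ n)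
    {B : Matrix (Fin (n + 1)) (Fin (n + 1)) F} (hB : B.det ≠ 0) (h : IsFilippov (LB B)) :
    B.transpose = B := by
  let p : Fin n := ⟨0, by lia⟩
  let q : Fin n := ⟨1, hn⟩
  have hqp : q ≠ p := by simp [p, q]
  have hBinj : Function.Injective B.mulVec :=
    Matrix.mulVec_injective_of_isUnit ((Matrix.isUnit_iff_isUnit_det B).2 hB.isUnit)
  have main : ∀ x, (B - B.transpose).mulVec (algD F n x) = 0 := by
    intro y
    let D := LinearMap.toMatrix' ((LB B).toLinearMap y p)
    have hD : ∀ u, D.mulVec u = B.mulVec (algD F n (Function.update y p u)) := by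
      intro u
      rw [← LB_eq_mulVec, ← Matrix.toLin'_apply, Matrix.toLin'_toMatrix']
      rfl
    have hsum : ∀ x, ∑ i, algD F n (Function.update x i (D.mulVec (x i))) =
        algD F n (Function.update y p (B.mulVec (algD F n x))) := by
      intro x
      apply hBinj
      rw [Matrix.mulVec_sum, ← LB_eq_mulVec, ← LB_eq_mulVec, h.2 p rfl]
      refine Finset.sum_congr rfl fun i _ => ?_
      rw [← LB_eq_mulVec, hD, ← LB_eq_mulVec]
    have key : ∀ z, (B - B.transpose).mulVec (algD F n (Function.update y p z)) =
        D.trace • z := by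
      intro z
      refine eq_of_algD_dotProduct_eq fun x => ?_
      have h1 := sum_algD_update D x z
      rw [← sum_dotProduct, hsum, algD_update_dotProduct_comm, hD] at h1
      rw [dotProduct_smul, smul_eq_mul, ← h1, Matrix.sub_mulVec, dotProduct_sub,
        Matrix.dotProduct_mulVec _ B.transpose, Matrix.vecMul_transpose,
        dotProduct_comm (B.mulVec (algD F n x))]
      ring
    rcases eq_or_ne (y q) 0 with hy | hy
    · rw [(algD F n).map_coord_zero q hy, Matrix.mulVec_zero]
    -- Taking `z = y q` repeats an argument, so the trace is `0`; then `z = y p` gives the claim.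
    · have h1 := key (y q)
      have h2 : algD F n (Function.update y p (y q)) = 0 :=
        (LB_anticommutative _).map_eq_zero_of_eq _ p q
          (by simp [Function.update_of_ne hqp]) hqp.symm
      rw [h2, Matrix.mulVec_zero, eq_comm, smul_eq_zero] at h1
      have h3 := key (y p)
      rwa [h1.resolve_right hy, zero_smul, Function.update_eq_self] at h3
  exact (sub_eq_zero.1 (eq_zero_of_mulVec_algD_eq_zero main)).symm

end LB

end NAry

/-! ### Transport along isomorphisms, and the final assembly. -/

namespace NAry

section Iso

variable {F : Type*} [Field F] {n : ℕ} {L : Type*} [AddCommGroup L] [Module F L]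
  {L' : Type*} [AddCommGroup L'] [Module F L'] {L'' : Type*} [AddCommGroup L''] [Module F L'']
  {μ : Mul F n L} {μ' : Mul F n L'} {μ'' : Mul F n L''}

theorem Iso.trans (h : Iso μ μ') (h' : Iso μ' μ'') : Iso μ μ'' := by
  obtain ⟨e, he⟩ := h
  obtain ⟨e', he'⟩ := h'
  exact ⟨e.trans e', fun x => by simp [he, he']⟩

theorem Iso.symm (h : Iso μ μ') : Iso μ' μ := by
  obtain ⟨e, he⟩ := h
  exact ⟨e.symm, fun x => by simp [LinearEquiv.symm_apply_eq, he]⟩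

theorem IsFilippov.of_iso (hμ : IsFilippov μ) (h : Iso μ μ') : IsFilippov μ' := by
  obtain ⟨e, he⟩ := h.symm
  have hu : ∀ (x : Fin n → L') i y, (fun j => e (Function.update x i y j)) =
      Function.update (fun j => e (x j)) i (e y) := fun x i y => by
    ext j
    exact Function.apply_update (fun _ => e) x i y j
  refine ⟨fun σ x => e.injective ?_, fun p hp x y => e.injective ?_⟩
  · rw [he]
    refine (hμ.1 σ fun i => e (x i)).trans ?_
    rw [← he]
    exact (map_zsmul e ((Equiv.Perm.sign σ : ℤˣ) : ℤ) _).symm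
  · simp only [map_sum, he, hu]
    exact hμ.2 p hp _ _

end Iso

end NAry

theorem theorem4p6 {F : Type*} [Field F] [CharZero F]
    {L : Type*} [AddCommGroup L] [Module F L] [FiniteDimensional F L]
    (n : ℕ) (hn : 2 ≤ n) (μ : NAry.Mul F n L) (hQ : NAry.QDerLL μ = ⊤) :
    (NAry.IsCommutative μ →
      (μ = 0 ∨ ∃ α : F, α ≠ 0 ∧ NAry.Iso μ (NAry.Lalpha F n α)) ∧
      (IsAlgClosed F → μ ≠ 0 →
        ∃ m : L →ₗ[F] L →ₗ[F] L,
          (∃ e : L ≃ₗ[F] F, ∀ x y : L, e (m x y) = e x * e y) ∧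
          ∀ x : Fin n → L, μ x = NAry.iterProd m x)) ∧
    (NAry.IsAnticommutative μ →
      (μ = 0 ∨ NAry.Iso μ (NAry.algA F n) ∨
        ∃ B : Matrix (Fin (n + 1)) (Fin (n + 1)) F, B.det ≠ 0 ∧ NAry.Iso μ (NAry.LB B)) ∧
      (IsAlgClosed F → NAry.IsFilippov μ →
        (∃ B : Matrix (Fin (n + 1)) (Fin (n + 1)) F, B.det ≠ 0 ∧ NAry.Iso μ (NAry.LB B)) →
        NAry.Iso μ (NAry.algD F n))) := by
  refine ⟨fun hμ => ?_, fun hμ => ⟨?_, ?_⟩⟩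
  · have hα : μ ≠ 0 → ∃ α : F, α ≠ 0 ∧ NAry.Iso μ (NAry.Lalpha F n α) := fun h0 =>
      NAry.exists_iso_Lalpha_of_finrank_le_one (hμ.finrank_le_one hn hQ h0) h0
    refine ⟨or_iff_not_imp_left.2 hα, fun _ h0 => ?_⟩
    obtain ⟨α, hα0, hiso⟩ := hα h0
    exact hiso.exists_mul_eq_iterProd hn hα0
  · refine or_iff_not_imp_left.2 fun h0 => ?_
    rcases hμ.finrank_eq hn hQ h0 with h | h
    · exact Or.inl (hμ.iso_algA hn h0 (Module.finBasisOfFinrankEq F L h))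
    · exact Or.inr (hμ.exists_iso_LB hQ h0 (Module.finBasisOfFinrankEq F L h))
  · rintro _ hF ⟨B, hB, hiso⟩
    obtain ⟨T, hT⟩ := Matrix.exists_mul_mul_transpose_eq_one
      ((hF.of_iso hiso).transpose_eq hn hB) hB
    -- The isomorphism built here has target `algD F n`, of dimension `n + 1`, while the stated
    -- conclusion names `algA F n`, of dimension `n`, which is not isomorphic to any `LB B`.
    exact hiso.trans (NAry.iso_LB_algD_of_congr_one hn hT)
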